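/- Let $n,m\ge 1$. Let $g_0=\sum_i\varepsilon_i\,dx_i^2$, $\varepsilon_i\in\{1,-1\}$, be a semi-Euclidean metric on $\mathbb R^n$, let $\alpha=(\alpha_1,\dots,\alpha_n)\neq 0$ and put $\xi(x)=\sum_i\alpha_ix_i$ and $\|\alpha\|^2=\sum_i\varepsilon_i\alpha_i^2$. Let $(F^m,g_F)$ be a non-empty $m$-dimensional semi-Riemannian manifold, let $\varphi,f,h,u:\mathbb R\to\mathbb R$ be smooth with $\varphi$ nowhere zero and $f>0$, and let $\lambda\in\mathbb R$ and $\theta\ge 0$. Regard $\varphi\circ\xi$, $f\circ\xi$, $h\circ\xi$, $u\circ\xi$ as functions on $\mathbb R^n$ and, through the projection $\pi:\mathbb R^n\times F\to\mathbb R^n$, on $M=\mathbb R^n\times F$, and give $M$ the warped product metric $$g=(\varphi\circ\xi)^{-2}g_0+(f\circ\xi)^2g_F .$$ Recall that $(M,g)$ with $U=u\circ\xi\circ\pi$, $h\circ\xi\circ\pi$, $\theta$ and $\lambda$ is a gradient Ricci-harmonic soliton (GRHS) if $$\mathrm{Ric}_g+\mathrm{Hess}_g(h\circ\xi\circ\pi)-\theta\,dU\otimes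 dU=\lambda g,\qquad \tau_gU-g(\nabla U,\nabla (h\circ\xi\circ\pi))=0,$$ where $\tau_gU=\mathrm{trace}_g(\nabla dU)$. Consider the two statements: (A) $M$ is a GRHS with these data and $U$ is non-constant. (B) $u$ is non-constant and there is a constant $\mu\in\mathbb R$ such that $\mathrm{Ric}_{g_F}=\mu g_F$ and the following equations hold on all of $\mathbb R$: $$(n-2)\frac{\varphi''}{\varphi}-m\frac{f''}{f}-2m\frac{\varphi'}{\varphi}\frac{f'}{f}+h''+2\frac{\varphi'}{\varphi}h'-\theta(u')^2=0,$$ $$\left[\frac{\varphi''}{\varphi}-(n-1)\left(\frac{\varphi'}{\varphi}\right)^2+m\frac{\varphi'}{\varphi}\frac{f'}{f}-\frac{\varphi'}{\varphi}h'\right]\|\alpha\|^2=\frac{\lambda}{\varphi^2},$$ $$\left[\frac{f''}{f}-(n-2)\frac{\varphi'}{\varphi}\frac{f'}{f}+(m-1)\left(\frac{f'}{f}\right)^2-\frac{f'}{f}h'\right]\|\alpha\|^2=\frac{\mu}{f^2\varphi^2}-\frac{\lambda}{\varphi^2},$$ $$\left[u''-(n-2)\frac{\varphi'}{\varphi}u'+mu'\frac{f'}{f}-u'h'\right]\|\alpha\|^2=0.$$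 If $n\ge 2$, then (A) holds if and only if (B) holds. For every $n\ge 1$, (B) implies (A). -/

import Mathlib

open scoped Manifold ContDiff

set_option maxSynthPendingDepth 3

noncomputable section

namespace GRHS

section General

variable {E : Type*} [NormedAddCommGroup E] [NormedSpace ℝ E]
  {H : Type*} [TopologicalSpace H] {I : ModelWithCorners ℝ E H}
  {M : Type*} [TopologicalSpace M] [ChartedSpace H M]
  {E' : Type*} [NormedAddCommGroup E'] [NormedSpace ℝ E']
  {H' : Type*} [TopologicalSpace H'] {I' : ModelWithCorners ℝ E' H'}
  {M' : Type*} [TopologicalSpace M'] [ChartedSpace H' M']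

/-- A field of bilinear forms on the tangent spaces of `M`. -/
abbrev BilinField (I : ModelWithCorners ℝ E H) (M : Type*) [TopologicalSpace M]
    [ChartedSpace H M] : Type _ :=
  (p : M) → TangentSpace I p →L[ℝ] TangentSpace I p →L[ℝ] ℝ

/-- The bilinear form `(v, w) ↦ b (A v, A w)`. -/
def pullbackForm (b : E →L[ℝ] E →L[ℝ] ℝ) (A : E' →L[ℝ] E) : E' →L[ℝ] E' →L[ℝ] ℝ :=
  b.bilinearComp A A

/-- The pullback `ψ^* g`: `(ψ^* g)_p (v, w) = g_{ψ p} (dψ_p v, dψ_p w)`. -/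
def pullback (ψ : M' → M) (g : BilinField I M) : BilinField I' M' := fun p =>
  pullbackForm (E := E) (E' := E') (g (ψ p)) (mfderiv I' I ψ p)

theorem pullback_apply (ψ : M' → M) (g : BilinField I M) (p : M') (v w : TangentSpace I' p) :
    pullback (I' := I') ψ g p v w = g (ψ p) (mfderiv I' I ψ p v) (mfderiv I' I ψ p w) := rfl

/-- The expression of `g` in the chart around `p`, a field of bilinear forms on the model vector
space `E` (meaningful on the target of the chart). -/
def inChart (g : BilinField I M) (p : M) : E → E →L[ℝ] E →L[ℝ] ℝ :=
  pullback (I := I) (I' := 𝓘(ℝ, E)) (extChartAt I p).symm g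

theorem inChart_apply (g : BilinField I M) (p : M) (y v w : E) :
    inChart g p y v w = g ((extChartAt I p).symm y)
      (mfderiv 𝓘(ℝ, E) I (extChartAt I p).symm y v)
      (mfderiv 𝓘(ℝ, E) I (extChartAt I p).symm y w) := rfl

/-- `g` is a semi-Riemannian metric on the boundaryless manifold `M`: a smooth field of
symmetric nondegenerate bilinear forms. Smoothness means that its coordinate expressions are
smooth. -/
structure IsSemiRiemannian (g : BilinField I M) : Prop where
  symm : ∀ (p : M) (v w : TangentSpace I p), g p v w = g p w v
  nondegenerate : ∀ (p : M) (v : TangentSpace I p), (∀ w, g p v w = 0) → v = 0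
  smooth : ∀ p : M, ContDiffOn ℝ ∞ (inChart g p) (extChartAt I p).target

/-- Christoffel symbols of the first kind of a metric `G` on (an open subset of) `E`, see
`christoffelLower_apply`. -/
def christoffelLower (G : E → E →L[ℝ] E →L[ℝ] ℝ) (y : E) : E →L[ℝ] E →L[ℝ] E →L[ℝ] ℝ :=
  (1 / 2 : ℝ) • (fderiv ℝ G y + (fderiv ℝ G y).flip -
    ((ContinuousLinearMap.flipₗᵢ ℝ E E ℝ).toContinuousLinearEquiv.toContinuousLinearMap ∘L
      (fderiv ℝ G y).flip : E →L[ℝ] E →L[ℝ] E →L[ℝ] ℝ))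

theorem christoffelLower_apply (G : E → E →L[ℝ] E →L[ℝ] ℝ) (y v w z : E) :
    christoffelLower G y v w z =
      (1 / 2 : ℝ) * (fderiv ℝ G y v w z + fderiv ℝ G y w v z - fderiv ℝ G y z v w) := rfl

/-- Christoffel symbols `Γ_y (v, w)` of the Levi-Civita connection of `G`: the index of
`christoffelLower` is raised with the inverse of `G y : E → E^*`. -/
def christoffel (G : E → E →L[ℝ] E →L[ℝ] ℝ) (y : E) : E →L[ℝ] E →L[ℝ] E :=
  (ContinuousLinearMap.compL ℝ E (E →L[ℝ] ℝ) E (G y).inverse) ∘L christoffelLower G y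

theorem christoffel_apply (G : E → E →L[ℝ] E →L[ℝ] ℝ) (y v w : E) :
    christoffel G y v w = (G y).inverse (christoffelLower G y v w) := rfl

/-- The endomorphism `z ↦ R (z, v) w` of the Riemann curvature tensor
`R (z, v) w = ∇_z ∇_v w - ∇_v ∇_z w - ∇_{[z, v]} w` of `G` at `y`, see `curvature_apply`. -/
def curvature (G : E → E →L[ℝ] E →L[ℝ] ℝ) (y v w : E) : E →L[ℝ] E :=
  ((fderiv ℝ (christoffel G) y).flip v).flip w - (fderiv ℝ (christoffel G) y v).flip w
    + (christoffel G y).flip (christoffel G y v w)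
    - (christoffel G y v) ∘L (christoffel G y).flip w

theorem curvature_apply (G : E → E →L[ℝ] E →L[ℝ] ℝ) (y v w z : E) :
    curvature G y v w z =
      fderiv ℝ (christoffel G) y z v w - fderiv ℝ (christoffel G) y v z w
        + christoffel G y z (christoffel G y v w)
        - christoffel G y v (christoffel G y z w) := rfl

/-- The Ricci tensor `Ric_g (v, w) = trace (z ↦ R (z, v) w)` at `p`. A tangent vector at `p` is
represented, as always for `TangentSpace I p`, by its coordinates in the preferred chart at `p`;
the curvature is computed in this chart. -/
def ricci (g : BilinField I M) (p : M) (v w : TangentSpace I p) : ℝ :=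
  LinearMap.trace ℝ E (curvature (inChart g p) (extChartAt I p p) v w : E →ₗ[ℝ] E)

/-- The Hessian of a function `a` on (an open subset of) `E` with respect to a metric `G`, see
`localHess_apply`. -/
def localHess (G : E → E →L[ℝ] E →L[ℝ] ℝ) (a : E → ℝ) (y : E) : E →L[ℝ] E →L[ℝ] ℝ :=
  fderiv ℝ (fderiv ℝ a) y -
    (ContinuousLinearMap.compL ℝ E E ℝ (fderiv ℝ a y)) ∘L christoffel G y

theorem localHess_apply (G : E → E →L[ℝ] E →L[ℝ] ℝ) (a : E → ℝ) (y v w : E) :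
    localHess G a y v w =
      fderiv ℝ (fderiv ℝ a) y v w - fderiv ℝ a y (christoffel G y v w) := rfl

/-- The Hessian `Hess_g a = ∇ da` at `p`, computed in the preferred chart at `p`. -/
def hess (g : BilinField I M) (a : M → ℝ) (p : M) :
    TangentSpace I p →L[ℝ] TangentSpace I p →L[ℝ] ℝ :=
  (localHess (inChart g p) (fun y => a ((extChartAt I p).symm y)) (extChartAt I p p) :
    E →L[ℝ] E →L[ℝ] ℝ)

/-- The differential of a real function. -/
def differential (I : ModelWithCorners ℝ E H) (a : M → ℝ) (p : M) : TangentSpace I p →L[ℝ] ℝ :=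
  mfderiv I 𝓘(ℝ, ℝ) a p

/-- The gradient of a real function: `g (grad a, ·) = da`. -/
def grad (g : BilinField I M) (a : M → ℝ) (p : M) : TangentSpace I p :=
  (g p).inverse (differential I a p)

/-- The tension field of a real function, `τ_g u = trace_g (∇ du)`. -/
def tension (g : BilinField I M) (u : M → ℝ) (p : M) : ℝ :=
  LinearMap.trace ℝ (TangentSpace I p)
    ((g p).inverse ∘L hess g u p : TangentSpace I p →L[ℝ] TangentSpace I p).toLinearMap

/-- `(M, g)`, with the real-valued map `u`, the potential `h` and the constants `θ ≥ 0` and `lam`,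
is a gradient Ricci-harmonic soliton. -/
structure IsGRHS (g : BilinField I M) (u h : M → ℝ) (θ lam : ℝ) : Prop where
  isSemiRiemannian : IsSemiRiemannian g
  theta_nonneg : 0 ≤ θ
  smooth_map : ContMDiff I 𝓘(ℝ, ℝ) ∞ u
  smooth_potential : ContMDiff I 𝓘(ℝ, ℝ) ∞ h
  ricci_eq : ∀ (p : M) (v w : TangentSpace I p),
    ricci g p v w + hess g h p v w - θ * (differential I u p v * differential I u p w)
      = lam * g p v w
  tension_eq : ∀ p : M, tension g u p - g p (grad g u p) (grad g h p) = 0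

/-- `Ric_g = μ g`. -/
def IsEinstein (g : BilinField I M) (μ : ℝ) : Prop :=
  ∀ (p : M) (v w : TangentSpace I p), ricci g p v w = μ * g p v w

/-- The warped product metric `π^* g_B + (f ∘ π)^2 σ^* g_F` on `B × F`. -/
def warpedMetric (gB : BilinField I M) (f : M → ℝ) (gF : BilinField I' M') :
    BilinField (I.prod I') (M × M') := fun p =>
  pullback (I' := I.prod I') Prod.fst gB p + (f p.1) ^ 2 • pullback (I' := I.prod I') Prod.snd gF p

end General

section Base

variable {n : ℕ}

/-- The linear function `ξ (x) = ∑ α_i x_i` on `ℝ^n`. -/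
def xi (α : Fin n → ℝ) (x : EuclideanSpace ℝ (Fin n)) : ℝ := ∑ i, α i * x i

/-- The semi-Euclidean bilinear form `∑ ε_i v_i w_i` on `ℝ^n`. -/
def semiEuclidean (ε : Fin n → ℝ) :
    EuclideanSpace ℝ (Fin n) →L[ℝ] EuclideanSpace ℝ (Fin n) →L[ℝ] ℝ :=
  ∑ i, ε i • (EuclideanSpace.proj i : EuclideanSpace ℝ (Fin n) →L[ℝ] ℝ).smulRight
    (EuclideanSpace.proj i : EuclideanSpace ℝ (Fin n) →L[ℝ] ℝ)

theorem semiEuclidean_apply (ε : Fin n → ℝ) (v w : EuclideanSpace ℝ (Fin n)) :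
    semiEuclidean ε v w = ∑ i, ε i * (v i * w i) := by
  simp [semiEuclidean]

/-- The metric `Φ^{-2} g_0` on `ℝ^n`, where `g_0 = ∑ ε_i dx_i^2`. -/
def conformalMetric (ε : Fin n → ℝ) (Φ : EuclideanSpace ℝ (Fin n) → ℝ) :
    BilinField (𝓡 n) (EuclideanSpace ℝ (Fin n)) := fun x =>
  ((Φ x ^ 2)⁻¹ • semiEuclidean ε :
    EuclideanSpace ℝ (Fin n) →L[ℝ] EuclideanSpace ℝ (Fin n) →L[ℝ] ℝ)

/-- The squared semi-Euclidean length `‖α‖² = ∑ ε_i α_i²`. -/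
def sqLength (ε α : Fin n → ℝ) : ℝ := ∑ i, ε i * α i ^ 2

end Base

/-- The system of ordinary differential equations, at the point `t`, for the functions
`φ, f, h, u` of one variable; `N` stands for `‖α‖²`. -/
structure SolvesSystemAt (n m : ℕ) (N θ lam μ : ℝ) (φ f h u : ℝ → ℝ) (t : ℝ) : Prop where
  eq1 : ((n : ℝ) - 2) * (deriv (deriv φ) t / φ t) - m * (deriv (deriv f) t / f t)
      - 2 * m * (deriv φ t / φ t) * (deriv f t / f t) + deriv (deriv h) t
      + 2 * (deriv φ t / φ t) * deriv h t - θ * deriv u t ^ 2 = 0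
  eq2 : (deriv (deriv φ) t / φ t - ((n : ℝ) - 1) * (deriv φ t / φ t) ^ 2
      + m * (deriv φ t / φ t) * (deriv f t / f t) - deriv φ t / φ t * deriv h t) * N
      = lam / φ t ^ 2
  eq3 : (deriv (deriv f) t / f t - ((n : ℝ) - 2) * (deriv φ t / φ t) * (deriv f t / f t)
      + ((m : ℝ) - 1) * (deriv f t / f t) ^ 2 - deriv f t / f t * deriv h t) * N
      = μ / (f t ^ 2 * φ t ^ 2) - lam / φ t ^ 2
  eq4 : (deriv (deriv u) t - ((n : ℝ) - 2) * (deriv φ t / φ t) * deriv u t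
      + m * deriv u t * (deriv f t / f t) - deriv u t * deriv h t) * N = 0

end GRHS

end

/-! The conformal factor, the warping function, the potential and the map all factor through ξ, so
in a product chart every tensor in the soliton equation is a combination of ξ⊗ξ, g₀, g_F and Ric_F,
without mixed terms, whose coefficients depend only on t = ξ(x). If A is the g₀-dual vector of ξ,
then ξ(A) = ‖α‖², which is how this number enters the system.

The Christoffel symbols are found in closed form (`christoffel_localWarped`), and the Ricci tensor,
the Hessian and the tension field follow from them. The result is `soliton_eq`: the defect of the
Ricci equation is Ric_F + E₁ ξ⊗ξ + E₂ g₀ − κ g_F. Here E₁ = 0 and E₂ = 0 are the first two equations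
of the system, and κ = μ is the third. By `tension_sub` the defect of the tension equation is φ²
times the left side of the fourth.

Thus (B) implies (A) by substitution, for every n. Conversely, vertical vectors give Ric_F = κ(t)
g_F for every t; since g_F ≠ 0 and the left side ignores t, κ is a constant μ. Horizontal vectors
give E₁ ξ⊗ξ + E₂ g₀ = 0, and for n ≥ 2 a form of rank one and a nondegenerate form are independent,
so E₁ = E₂ = 0. On a line the two forms are proportional, and this last step is lost. Surjectivity
of ξ makes the equations hold at every real t. -/

namespace GRHS

/-! ### Levi-Civita calculus for a metric on a vector space -/

section LocalMetric

variable {E : Type*} [NormedAddCommGroup E] [NormedSpace ℝ E]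

theorem isInvertible_of_nondegenerate [FiniteDimensional ℝ E] (b : E →L[ℝ] E →L[ℝ] ℝ)
    (hb : ∀ v, (∀ w, b v w = 0) → v = 0) : b.IsInvertible := by
  have hinj : Function.Injective (b : E →ₗ[ℝ] E →L[ℝ] ℝ) := by
    rw [← LinearMap.ker_eq_bot, LinearMap.ker_eq_bot']
    intro v hv
    exact hb v fun w => by
      have := congrArg (fun l : E →L[ℝ] ℝ => l w) hv
      simpa using this
  have hdim : Module.finrank ℝ E = Module.finrank ℝ (E →L[ℝ] ℝ) := by
    rw [← LinearEquiv.finrank_eq (LinearMap.toContinuousLinearMap : (E →ₗ[ℝ] ℝ) ≃ₗ[ℝ] _)]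
    exact (Subspace.dual_finrank_eq (K := ℝ) (V := E)).symm
  refine ⟨(LinearEquiv.ofInjectiveOfFinrankEq (b : E →ₗ[ℝ] E →L[ℝ] ℝ) hinj
    hdim).toContinuousLinearEquiv, ?_⟩
  ext v w
  rfl

variable {G : E → E →L[ℝ] E →L[ℝ] ℝ} {y : E}

theorem christoffel_lower (hG : (G y).IsInvertible) (v w z : E) :
    G y (christoffel G y v w) z = christoffelLower G y v w z := by
  rw [christoffel_apply, hG.self_apply_inverse]

/-- Since the metric is invertible, a guessed Christoffel symbol can be verified after lowering its
index; no inverse metric has to be computed. -/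
theorem christoffel_eq (hG : (G y).IsInvertible) {v w X : E}
    (h : ∀ z, G y X z = christoffelLower G y v w z) : christoffel G y v w = X := by
  rw [christoffel_apply, hG.inverse_apply_eq]
  ext z
  rw [h]

theorem fderiv_apply₂ {F₁ F₂ F₃ : Type*} [NormedAddCommGroup F₁] [NormedSpace ℝ F₁]
    [NormedAddCommGroup F₂] [NormedSpace ℝ F₂] [NormedAddCommGroup F₃] [NormedSpace ℝ F₃]
    {B : E → F₁ →L[ℝ] F₂ →L[ℝ] F₃} (hB : DifferentiableAt ℝ B y) (z : E) (v : F₁) (w : F₂) :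
    fderiv ℝ B y z v w = fderiv ℝ (fun x => B x v w) y z := by
  have h := ((hB.hasFDerivAt.clm_apply (hasFDerivAt_const v y)).clm_apply
    (hasFDerivAt_const w y)).fderiv
  rw [h]
  simp

/-- The first two terms are exchanged by swapping `v` and `w`. The third is symmetric because
symmetry of `G` near `y` passes to its derivative. -/
theorem christoffelLower_comm (hG : DifferentiableAt ℝ G y)
    (hs : ∀ᶠ x in nhds y, ∀ v w, G x v w = G x w v) (v w z : E) :
    christoffelLower G y v w z = christoffelLower G y w v z := by
  have : fderiv ℝ G y z v w = fderiv ℝ G y z w v := by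
    rw [fderiv_apply₂ hG, fderiv_apply₂ hG]
    congr 1
    apply Filter.EventuallyEq.fderiv_eq
    filter_upwards [hs] with x hx using hx v w
  rw [christoffelLower_apply, christoffelLower_apply, this]
  ring

theorem christoffel_comm (hG : DifferentiableAt ℝ G y)
    (hs : ∀ᶠ x in nhds y, ∀ v w, G x v w = G x w v) (v w : E) :
    christoffel G y v w = christoffel G y w v := by
  rw [christoffel_apply, christoffel_apply]
  congr 1
  ext z
  exact christoffelLower_comm hG hs v w z

theorem differentiableAt_christoffel [CompleteSpace E] (hG : ContDiffAt ℝ 2 G y)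
    (hi : (G y).IsInvertible) : DifferentiableAt ℝ (christoffel G) y := by
  have h1 : DifferentiableAt ℝ (fderiv ℝ G) y :=
    (hG.fderiv_right (m := 1) (by norm_num)).differentiableAt (by norm_num)
  have h2 : DifferentiableAt ℝ (fun x => (fderiv ℝ G x).flip) y :=
    (ContinuousLinearMap.flipₗᵢ ℝ E E
      (E →L[ℝ] ℝ)).toContinuousLinearEquiv.differentiableAt.comp y h1
  have h3 : DifferentiableAt ℝ (christoffelLower G) y := by
    unfold christoffelLower
    fun_prop
  have h4 : DifferentiableAt ℝ (fun x => (G x).inverse) y :=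
    ((hi.contDiffAt_map_inverse (n := 1)).differentiableAt (by norm_num)).comp y
      (hG.differentiableAt (by norm_num))
  unfold christoffel
  fun_prop

theorem christoffel_congr {G' : E → E →L[ℝ] E →L[ℝ] ℝ} (h : G =ᶠ[nhds y] G') :
    christoffel G =ᶠ[nhds y] christoffel G' := by
  filter_upwards [h.eventuallyEq_nhds] with x hx
  unfold christoffel christoffelLower
  rw [hx.fderiv_eq, hx.eq_of_nhds]

/-- Curvature depends only on the germ of the metric. This is needed because the explicit warped
form agrees with the chart expression only on the chart target. -/
theorem curvature_congr {G' : E → E →L[ℝ] E →L[ℝ] ℝ} (h : G =ᶠ[nhds y] G') (v w : E) :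
    curvature G y v w = curvature G' y v w := by
  have h' := christoffel_congr h
  unfold curvature
  rw [h'.fderiv_eq, h'.eq_of_nhds]

theorem localHess_congr {G' : E → E →L[ℝ] E →L[ℝ] ℝ} (h : G =ᶠ[nhds y] G') (a : E → ℝ) :
    localHess G a y = localHess G' a y := by
  unfold localHess
  rw [(christoffel_congr h).eq_of_nhds]

end LocalMetric

/-! ### Trace on a product -/

section Trace

variable {E E' : Type*} [AddCommGroup E] [Module ℝ E] [AddCommGroup E'] [Module ℝ E']
  [FiniteDimensional ℝ E] [FiniteDimensional ℝ E']

/-- Split `L` by its output component and use cyclicity of the trace. The off-diagonal blocks of the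
curvature therefore never have to be computed. -/
theorem trace_prod (L : E × E' →ₗ[ℝ] E × E') :
    LinearMap.trace ℝ (E × E') L =
      LinearMap.trace ℝ E (LinearMap.fst ℝ E E' ∘ₗ L ∘ₗ LinearMap.inl ℝ E E') +
      LinearMap.trace ℝ E' (LinearMap.snd ℝ E E' ∘ₗ L ∘ₗ LinearMap.inr ℝ E E') := by
  have h : L = LinearMap.inl ℝ E E' ∘ₗ (LinearMap.fst ℝ E E' ∘ₗ L) +
      LinearMap.inr ℝ E E' ∘ₗ (LinearMap.snd ℝ E E' ∘ₗ L) := by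
    ext x <;> simp
  conv_lhs => rw [h]
  rw [map_add, LinearMap.trace_comp_comm', LinearMap.trace_comp_comm' _ (LinearMap.inr ℝ E E')]
  rfl

end Trace

/-- `G` is a semi-Riemannian metric on the open subset `V` of a vector space. -/
structure IsMetricOn {E : Type*} [NormedAddCommGroup E] [NormedSpace ℝ E]
    (G : E → E →L[ℝ] E →L[ℝ] ℝ) (V : Set E) : Prop where
  isOpen : IsOpen V
  smooth : ContDiffOn ℝ ∞ G V
  symm : ∀ y ∈ V, ∀ v w, G y v w = G y w v
  nondegenerate : ∀ y ∈ V, ∀ v, (∀ w, G y v w = 0) → v = 0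

namespace IsMetricOn

variable {E : Type*} [NormedAddCommGroup E] [NormedSpace ℝ E]
  {G : E → E →L[ℝ] E →L[ℝ] ℝ} {V : Set E} {y : E}

theorem contDiffAt (hG : IsMetricOn G V) (hy : y ∈ V) : ContDiffAt ℝ ∞ G y :=
  hG.smooth.contDiffAt (hG.isOpen.mem_nhds hy)

theorem differentiableAt (hG : IsMetricOn G V) (hy : y ∈ V) : DifferentiableAt ℝ G y :=
  (hG.contDiffAt hy).differentiableAt (by simp)

theorem isInvertible [FiniteDimensional ℝ E] (hG : IsMetricOn G V) (hy : y ∈ V) :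
    (G y).IsInvertible :=
  isInvertible_of_nondegenerate _ (hG.nondegenerate y hy)

theorem differentiableAt_christoffel [FiniteDimensional ℝ E] (hG : IsMetricOn G V) (hy : y ∈ V) :
    DifferentiableAt ℝ (christoffel G) y :=
  have : CompleteSpace E := FiniteDimensional.complete ℝ E
  GRHS.differentiableAt_christoffel ((hG.contDiffAt hy).of_le (by norm_cast))
    (hG.isInvertible hy)

theorem christoffel_comm (hG : IsMetricOn G V) (hy : y ∈ V) (v w : E) :
    christoffel G y v w = christoffel G y w v :=
  GRHS.christoffel_comm (hG.differentiableAt hy)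
    (by filter_upwards [hG.isOpen.mem_nhds hy] with x hx using hG.symm x hx) v w

end IsMetricOn

/-! ### The warped metric in coordinates and its Christoffel symbols -/

section Warped

variable {E₁ E₂ : Type*} [NormedAddCommGroup E₁] [NormedSpace ℝ E₁]
  [NormedAddCommGroup E₂] [NormedSpace ℝ E₂]

/-- The metric `(φ ∘ ξ)^{-2} g₀ + (f ∘ ξ)^2 GF` on `E₁ × E₂`. -/
noncomputable def localWarped (ξ : E₁ →L[ℝ] ℝ) (g₀ : E₁ →L[ℝ] E₁ →L[ℝ] ℝ) (φ f : ℝ → ℝ)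
    (GF : E₂ → E₂ →L[ℝ] E₂ →L[ℝ] ℝ) (p : E₁ × E₂) : E₁ × E₂ →L[ℝ] E₁ × E₂ →L[ℝ] ℝ :=
  (φ (ξ p.1) ^ 2)⁻¹ • g₀.bilinearComp (.fst ℝ E₁ E₂) (.fst ℝ E₁ E₂) +
    f (ξ p.1) ^ 2 • (GF p.2).bilinearComp (.snd ℝ E₁ E₂) (.snd ℝ E₁ E₂)

variable {ξ : E₁ →L[ℝ] ℝ} {g₀ : E₁ →L[ℝ] E₁ →L[ℝ] ℝ} {A : E₁} {φ f : ℝ → ℝ}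
  {GF : E₂ → E₂ →L[ℝ] E₂ →L[ℝ] ℝ} {V : Set E₂}

theorem localWarped_apply (p v w : E₁ × E₂) :
    localWarped ξ g₀ φ f GF p v w =
      (φ (ξ p.1) ^ 2)⁻¹ * g₀ v.1 w.1 + f (ξ p.1) ^ 2 * GF p.2 v.2 w.2 := rfl

theorem hasFDerivAt_comp_fst {k : ℝ → ℝ} {k' : ℝ} {p : E₁ × E₂} (h : HasDerivAt k k' (ξ p.1)) :
    HasFDerivAt (fun p : E₁ × E₂ => k (ξ p.1)) (k' • ξ ∘L .fst ℝ E₁ E₂) p :=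
  h.comp_hasFDerivAt p (ξ ∘L ContinuousLinearMap.fst ℝ E₁ E₂).hasFDerivAt

theorem fderiv_comp_fst {k : ℝ → ℝ} (hk : ContDiff ℝ ∞ k) (p v : E₁ × E₂) :
    fderiv ℝ (fun p : E₁ × E₂ => k (ξ p.1)) p v = deriv k (ξ p.1) * ξ v.1 := by
  rw [(hasFDerivAt_comp_fst (hk.differentiable (by simp) _).hasDerivAt).fderiv]
  rfl

theorem hasFDerivAt_bilin_comp_snd {F₃ : Type*} [NormedAddCommGroup F₃] [NormedSpace ℝ F₃]
    {B : E₂ → E₂ →L[ℝ] E₂ →L[ℝ] F₃} {q : E₁ × E₂} (h : DifferentiableAt ℝ B q.2) (v w : E₂) :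
    HasFDerivAt (fun p : E₁ × E₂ => B p.2 v w)
      (((fderiv ℝ B q.2).flip v).flip w ∘L .snd ℝ E₁ E₂) q := by
  have h1 : HasFDerivAt (fun y => B y v w) (((fderiv ℝ B q.2).flip v).flip w) q.2 := by
    have := (h.hasFDerivAt.clm_apply (hasFDerivAt_const v q.2)).clm_apply (hasFDerivAt_const w q.2)
    refine this.congr_fderiv ?_
    ext; simp
  exact h1.comp q (ContinuousLinearMap.snd ℝ E₁ E₂).hasFDerivAt

/-- Data for the local computations in a warped product. -/
structure IsWarpedOn (ξ : E₁ →L[ℝ] ℝ) (g₀ : E₁ →L[ℝ] E₁ →L[ℝ] ℝ) (A : E₁) (φ f : ℝ → ℝ)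
    (GF : E₂ → E₂ →L[ℝ] E₂ →L[ℝ] ℝ) (V : Set E₂) : Prop where
  symm : ∀ v w, g₀ v w = g₀ w v
  nondegenerate : ∀ v, (∀ w, g₀ v w = 0) → v = 0
  dual : ∀ v, g₀ A v = ξ v
  smooth_phi : ContDiff ℝ ∞ φ
  smooth_f : ContDiff ℝ ∞ f
  phi_ne : ∀ t, φ t ≠ 0
  f_ne : ∀ t, f t ≠ 0
  fiber : IsMetricOn GF V

namespace IsWarpedOn

theorem isMetricOn [FiniteDimensional ℝ E₁] [FiniteDimensional ℝ E₂]
    (H : IsWarpedOn ξ g₀ A φ f GF V) :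
    IsMetricOn (localWarped ξ g₀ φ f GF) (Prod.snd ⁻¹' V) where
  isOpen := H.fiber.isOpen.preimage continuous_snd
  smooth := by
    unfold localWarped
    have h1 : ContDiff ℝ ∞ fun p : E₁ × E₂ => φ (ξ p.1) :=
      H.smooth_phi.comp (ξ.contDiff.comp contDiff_fst)
    have h2 : ContDiff ℝ ∞ fun p : E₁ × E₂ => f (ξ p.1) :=
      H.smooth_f.comp (ξ.contDiff.comp contDiff_fst)
    have h3 : ContDiffOn ℝ ∞ (fun p : E₁ × E₂ => GF p.2) (Prod.snd ⁻¹' V) :=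
      H.fiber.smooth.comp contDiff_snd.contDiffOn fun p hp => hp
    have h4 : ContDiffOn ℝ ∞ (fun p : E₁ × E₂ => (GF p.2).bilinearComp (.snd ℝ E₁ E₂)
        (.snd ℝ E₁ E₂)) (Prod.snd ⁻¹' V) := by
      refine contDiffOn_clm_apply.2 fun v => contDiffOn_clm_apply.2 fun w => ?_
      exact (h3.clm_apply contDiffOn_const).clm_apply contDiffOn_const
    exact ((((h1.pow 2).inv fun p => pow_ne_zero 2 (H.phi_ne _)).smul contDiff_const).contDiffOn).add
      ((h2.pow 2).contDiffOn.smul h4)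
  symm p hp v w := by
    rw [localWarped_apply, localWarped_apply, H.symm, H.fiber.symm _ hp]
  nondegenerate p hp v hv := by
    refine Prod.ext (H.nondegenerate _ fun w => ?_) (H.fiber.nondegenerate _ hp _ fun w => ?_)
    · have := hv (w, 0)
      rw [localWarped_apply] at this
      simpa [H.phi_ne] using this
    · have := hv (0, w)
      rw [localWarped_apply] at this
      simpa [H.f_ne] using this

theorem hasDerivAt_phi (H : IsWarpedOn ξ g₀ A φ f GF V) (t : ℝ) : HasDerivAt φ (deriv φ t) t :=
  (H.smooth_phi.differentiable (by simp) t).hasDerivAt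

theorem hasDerivAt_f (H : IsWarpedOn ξ g₀ A φ f GF V) (t : ℝ) : HasDerivAt f (deriv f t) t :=
  (H.smooth_f.differentiable (by simp) t).hasDerivAt

theorem fderiv_localWarped [FiniteDimensional ℝ E₁] [FiniteDimensional ℝ E₂]
    (H : IsWarpedOn ξ g₀ A φ f GF V) {p : E₁ × E₂} (hp : p.2 ∈ V)
    (v w z : E₁ × E₂) :
    fderiv ℝ (localWarped ξ g₀ φ f GF) p v w z =
      -2 * deriv φ (ξ p.1) / φ (ξ p.1) ^ 3 * ξ v.1 * g₀ w.1 z.1 +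
      2 * f (ξ p.1) * deriv f (ξ p.1) * ξ v.1 * GF p.2 w.2 z.2 +
      f (ξ p.1) ^ 2 * fderiv ℝ GF p.2 v.2 w.2 z.2 := by
  rw [fderiv_apply₂ (H.isMetricOn.differentiableAt hp)]
  simp only [localWarped_apply]
  have h0 := H.phi_ne (ξ p.1)
  have h1 := (((H.hasDerivAt_phi (ξ p.1)).fun_pow 2).fun_inv (pow_ne_zero 2 h0))
  have h2 := (H.hasDerivAt_f (ξ p.1)).fun_pow 2
  rw [(((hasFDerivAt_comp_fst h1).mul_const (g₀ w.1 z.1)).fun_add ((hasFDerivAt_comp_fst h2).fun_mul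
    (hasFDerivAt_bilin_comp_snd (H.fiber.differentiableAt hp) w.2 z.2))).fderiv]
  simp
  field_simp
  ring

theorem christoffel_localWarped [FiniteDimensional ℝ E₁] [FiniteDimensional ℝ E₂]
    (H : IsWarpedOn ξ g₀ A φ f GF V) {p : E₁ × E₂} (hp : p.2 ∈ V) (v w : E₁ × E₂) :
    christoffel (localWarped ξ g₀ φ f GF) p v w =
      (-(deriv φ (ξ p.1) / φ (ξ p.1)) • (ξ v.1 • w.1 + ξ w.1 • v.1 - g₀ v.1 w.1 • A) -
        ((f (ξ p.1) * deriv f (ξ p.1) * φ (ξ p.1) ^ 2) * GF p.2 v.2 w.2) • A,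
       christoffel GF p.2 v.2 w.2 +
        (deriv f (ξ p.1) / f (ξ p.1)) • (ξ v.1 • w.2 + ξ w.1 • v.2)) := by
  -- The stated value is checked against the Koszul expression; `H.dual` turns pairings with `A`
  -- into `ξ`.
  apply christoffel_eq (H.isMetricOn.isInvertible hp)
  intro z
  have h0 := H.phi_ne (ξ p.1)
  have h1 := H.f_ne (ξ p.1)
  rw [christoffelLower_apply, H.fderiv_localWarped hp, H.fderiv_localWarped hp,
    H.fderiv_localWarped hp, localWarped_apply]
  simp only [map_add, map_sub, map_smul, add_apply, smul_eq_mul,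
    sub_apply, smul_apply,
    christoffel_lower (H.fiber.isInvertible hp), christoffelLower_apply, H.dual]
  field_simp
  ring

end IsWarpedOn

end Warped

/-! ### Curvature of the warped metric -/

namespace IsWarpedOn

variable {E₁ E₂ : Type*} [NormedAddCommGroup E₁] [NormedSpace ℝ E₁] [FiniteDimensional ℝ E₁]
  [NormedAddCommGroup E₂] [NormedSpace ℝ E₂] [FiniteDimensional ℝ E₂]
  {ξ : E₁ →L[ℝ] ℝ} {g₀ : E₁ →L[ℝ] E₁ →L[ℝ] ℝ} {A : E₁} {φ f : ℝ → ℝ}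
  {GF : E₂ → E₂ →L[ℝ] E₂ →L[ℝ] ℝ} {V : Set E₂}

/-- The derivatives of φ'/φ, f'/f and f f' φ² are kept as parameters, so that the traces below stay
polynomial; they are expanded only in `trace_curvature_localWarped`. -/
theorem fderiv_christoffel_localWarped (H : IsWarpedOn ξ g₀ A φ f GF V) {p : E₁ × E₂}
    (hp : p.2 ∈ V) {a' b' c' : ℝ}
    (ha : HasDerivAt (fun t => deriv φ t / φ t) a' (ξ p.1))
    (hb : HasDerivAt (fun t => deriv f t / f t) b' (ξ p.1))
    (hc : HasDerivAt (fun t => f t * deriv f t * φ t ^ 2) c' (ξ p.1)) (z v w : E₁ × E₂) :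
    fderiv ℝ (christoffel (localWarped ξ g₀ φ f GF)) p z v w =
      ((-(a' * ξ z.1)) • (ξ v.1 • w.1 + ξ w.1 • v.1 - g₀ v.1 w.1 • A) -
        (c' * ξ z.1 * GF p.2 v.2 w.2 + f (ξ p.1) * deriv f (ξ p.1) * φ (ξ p.1) ^ 2 *
          fderiv ℝ GF p.2 z.2 v.2 w.2) • A,
       fderiv ℝ (christoffel GF) p.2 z.2 v.2 w.2 +
        (b' * ξ z.1) • (ξ v.1 • w.2 + ξ w.1 • v.2)) := by
  rw [fderiv_apply₂ (H.isMetricOn.differentiableAt_christoffel hp)]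
  -- The closed formula holds on the whole open set over `V`, so it may be differentiated.
  have hev : (fun x => christoffel (localWarped ξ g₀ φ f GF) x v w) =ᶠ[nhds p] fun p =>
      (-(deriv φ (ξ p.1) / φ (ξ p.1)) • (ξ v.1 • w.1 + ξ w.1 • v.1 - g₀ v.1 w.1 • A) -
        ((f (ξ p.1) * deriv f (ξ p.1) * φ (ξ p.1) ^ 2) * GF p.2 v.2 w.2) • A,
       christoffel GF p.2 v.2 w.2 +
        (deriv f (ξ p.1) / f (ξ p.1)) • (ξ v.1 • w.2 + ξ w.1 • v.2)) := by
    filter_upwards [H.isMetricOn.isOpen.mem_nhds hp] with x hx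
    exact H.christoffel_localWarped hx v w
  rw [hev.fderiv_eq]
  have h1 := (hasFDerivAt_comp_fst (E₂ := E₂) ha).fun_neg.smul_const
    (ξ v.1 • w.1 + ξ w.1 • v.1 - g₀ v.1 w.1 • A)
  have h2 := (((hasFDerivAt_comp_fst (E₂ := E₂) hc).fun_mul (hasFDerivAt_bilin_comp_snd
    (H.fiber.differentiableAt hp) v.2 w.2))).smul_const A
  have h3 := hasFDerivAt_bilin_comp_snd (E₁ := E₁) (H.fiber.differentiableAt_christoffel hp) v.2 w.2
  have h4 := (hasFDerivAt_comp_fst (E₂ := E₂) hb).smul_const (ξ v.1 • w.2 + ξ w.1 • v.2)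
  rw [((h1.fun_sub h2).prodMk (h3.fun_add h4)).fderiv]
  ext1
  · simp
    module
  · simp

variable {p : E₁ × E₂} {a' b' c' : ℝ}

/-- The horizontal block is a sum of multiples of the identity and of rank-one maps, whose traces
are evaluations of their functionals. -/
theorem trace_base (H : IsWarpedOn ξ g₀ A φ f GF V) (hp : p.2 ∈ V)
    (ha : HasDerivAt (fun t => deriv φ t / φ t) a' (ξ p.1))
    (hb : HasDerivAt (fun t => deriv f t / f t) b' (ξ p.1))
    (hc : HasDerivAt (fun t => f t * deriv f t * φ t ^ 2) c' (ξ p.1)) (v w : E₁ × E₂)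
    {a b c : ℝ} (ha0 : a = deriv φ (ξ p.1) / φ (ξ p.1)) (hb0 : b = deriv f (ξ p.1) / f (ξ p.1))
    (hc0 : c = f (ξ p.1) * deriv f (ξ p.1) * φ (ξ p.1) ^ 2) :
    LinearMap.trace ℝ E₁ (LinearMap.fst ℝ E₁ E₂ ∘ₗ
      (curvature (localWarped ξ g₀ φ f GF) p v w : E₁ × E₂ →ₗ[ℝ] E₁ × E₂) ∘ₗ
        LinearMap.inl ℝ E₁ E₂) =
      (Module.finrank ℝ E₁ - 2) * (a' + a ^ 2) * (ξ v.1 * ξ w.1) +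
        (a' - (Module.finrank ℝ E₁ - 2) * a ^ 2) * ξ A * g₀ v.1 w.1 +
        (Module.finrank ℝ E₁ * a * c - c' + b * c) * ξ A * GF p.2 v.2 w.2 := by
  set n : ℝ := ((Module.finrank ℝ E₁ : ℕ) : ℝ)
  set r : E₁ → E₁ →ₗ[ℝ] E₁ := fun x => (ξ : E₁ →ₗ[ℝ] ℝ).smulRight x with hr
  set s : E₁ → E₁ →ₗ[ℝ] E₁ := fun x => (g₀ x : E₁ →ₗ[ℝ] ℝ).smulRight A with hs
  -- `X` is the base part of Γ(v, w), and `Y` sends a horizontal z to the base part of Γ(z, w). The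
  -- fiber part of Γ(z, w) is b ξ(z) w₂, which produces the last term of `key`.
  set X : E₁ := -a • (ξ v.1 • w.1 + ξ w.1 • v.1 - g₀ v.1 w.1 • A) - (c * GF p.2 v.2 w.2) • A with hX
  set Y : E₁ →ₗ[ℝ] E₁ := -a • (r w.1 + ξ w.1 • LinearMap.id - s w.1) with hY
  have key : LinearMap.fst ℝ E₁ E₂ ∘ₗ
      (curvature (localWarped ξ g₀ φ f GF) p v w : E₁ × E₂ →ₗ[ℝ] E₁ × E₂) ∘ₗ
        LinearMap.inl ℝ E₁ E₂ =
      (-a' • (ξ v.1 • r w.1 + ξ w.1 • r v.1 - g₀ v.1 w.1 • r A) - (c' * GF p.2 v.2 w.2) • r A)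
      + (a' * ξ v.1) • (r w.1 + ξ w.1 • LinearMap.id - s w.1)
      - a • (r X + ξ X • LinearMap.id - s X)
      + a • (ξ v.1 • Y + ((ξ : E₁ →ₗ[ℝ] ℝ) ∘ₗ Y).smulRight v.1 -
          ((g₀ v.1 : E₁ →ₗ[ℝ] ℝ) ∘ₗ Y).smulRight A)
      + (c * b * GF p.2 v.2 w.2) • r A := by
    ext z
    simp only [LinearMap.comp_apply, LinearMap.inl_apply, LinearMap.fst_apply,
      ContinuousLinearMap.coe_coe, curvature_apply, H.fderiv_christoffel_localWarped hp ha hb hc,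
      H.christoffel_localWarped hp, ← ha0, ← hb0, ← hc0]
    simp [hr, hs, hY, hX, H.symm z]
    module
  rw [key]
  have tr (x : E₁) : LinearMap.trace ℝ E₁ (r x) = ξ x := LinearMap.trace_smulRight _ _
  have ts (x : E₁) : LinearMap.trace ℝ E₁ (s x) = ξ x := by
    rw [hs, LinearMap.trace_smulRight, ContinuousLinearMap.coe_coe, H.symm, H.dual]
  simp only [map_add, map_sub, map_smul, tr, ts, LinearMap.trace_smulRight, LinearMap.trace_id,
    hX, hY, smul_eq_mul]
  simp [hr, hs, H.dual, H.symm w.1 v.1, H.symm w.1 A]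
  ring

/-- In the vertical block the terms pairing b with the Christoffel symbols of the fiber cancel,
because those symbols are symmetric. What remains is the curvature of the fiber, a multiple of the
identity and one rank-one map. -/
theorem trace_fiber (H : IsWarpedOn ξ g₀ A φ f GF V) (hp : p.2 ∈ V)
    (ha : HasDerivAt (fun t => deriv φ t / φ t) a' (ξ p.1))
    (hb : HasDerivAt (fun t => deriv f t / f t) b' (ξ p.1))
    (hc : HasDerivAt (fun t => f t * deriv f t * φ t ^ 2) c' (ξ p.1)) (v w : E₁ × E₂)
    {a b c : ℝ} (ha0 : a = deriv φ (ξ p.1) / φ (ξ p.1)) (hb0 : b = deriv f (ξ p.1) / f (ξ p.1))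
    (hc0 : c = f (ξ p.1) * deriv f (ξ p.1) * φ (ξ p.1) ^ 2) :
    LinearMap.trace ℝ E₂ (LinearMap.snd ℝ E₁ E₂ ∘ₗ
      (curvature (localWarped ξ g₀ φ f GF) p v w : E₁ × E₂ →ₗ[ℝ] E₁ × E₂) ∘ₗ
        LinearMap.inr ℝ E₁ E₂) =
      LinearMap.trace ℝ E₂ (curvature GF p.2 v.2 w.2 : E₂ →ₗ[ℝ] E₂) -
        Module.finrank ℝ E₂ * (b' + b ^ 2 + 2 * a * b) * (ξ v.1 * ξ w.1) +
        Module.finrank ℝ E₂ * a * b * ξ A * g₀ v.1 w.1 +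
        (1 - Module.finrank ℝ E₂) * b * c * ξ A * GF p.2 v.2 w.2 := by
  set X : E₁ := -a • (ξ v.1 • w.1 + ξ w.1 • v.1 - g₀ v.1 w.1 • A) - (c * GF p.2 v.2 w.2) • A with hX
  have key : LinearMap.snd ℝ E₁ E₂ ∘ₗ
      (curvature (localWarped ξ g₀ φ f GF) p v w : E₁ × E₂ →ₗ[ℝ] E₁ × E₂) ∘ₗ
        LinearMap.inr ℝ E₁ E₂ =
      (curvature GF p.2 v.2 w.2 : E₂ →ₗ[ℝ] E₂) + (b * ξ X - (b' + b ^ 2) * (ξ v.1 * ξ w.1)) •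
        LinearMap.id + (b * c * ξ A) • (GF p.2 w.2 : E₂ →ₗ[ℝ] ℝ).smulRight v.2 := by
    ext z
    simp only [LinearMap.comp_apply, LinearMap.inr_apply, LinearMap.snd_apply,
      ContinuousLinearMap.coe_coe, curvature_apply, H.fderiv_christoffel_localWarped hp ha hb hc,
      H.christoffel_localWarped hp, ← ha0, ← hb0, ← hc0]
    simp [hX, H.fiber.symm _ hp z, H.fiber.christoffel_comm hp z, curvature_apply]
    module
  rw [key]
  simp only [map_add, map_smul, LinearMap.trace_smulRight, LinearMap.trace_id, smul_eq_mul, hX,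
    ContinuousLinearMap.coe_coe, map_sub, H.fiber.symm _ hp w.2]
  ring

theorem trace_curvature_localWarped (H : IsWarpedOn ξ g₀ A φ f GF V) (hp : p.2 ∈ V)
    (v w : E₁ × E₂) {t : ℝ} (ht : t = ξ p.1) {n m : ℝ} (hn : n = Module.finrank ℝ E₁)
    (hm : m = Module.finrank ℝ E₂) :
    LinearMap.trace ℝ (E₁ × E₂)
      (curvature (localWarped ξ g₀ φ f GF) p v w : E₁ × E₂ →ₗ[ℝ] E₁ × E₂) =
      LinearMap.trace ℝ E₂ (curvature GF p.2 v.2 w.2 : E₂ →ₗ[ℝ] E₂) +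
      ((n - 2) * (deriv (deriv φ) t / φ t) - m * (deriv (deriv f) t / f t)
        - 2 * m * (deriv φ t / φ t) * (deriv f t / f t)) * (ξ v.1 * ξ w.1) +
      (deriv (deriv φ) t / φ t - (n - 1) * (deriv φ t / φ t) ^ 2
        + m * (deriv φ t / φ t) * (deriv f t / f t)) * ξ A * g₀ v.1 w.1 -
      (deriv (deriv f) t / f t - (n - 2) * (deriv φ t / φ t) * (deriv f t / f t)
        + (m - 1) * (deriv f t / f t) ^ 2) * ξ A * (f t ^ 2 * φ t ^ 2) * GF p.2 v.2 w.2 := by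
  have hφ' : HasDerivAt (deriv φ) (deriv (deriv φ) t) t :=
    ((H.smooth_phi.deriv' (n := ∞)).differentiable (by simp) t).hasDerivAt
  have hf' : HasDerivAt (deriv f) (deriv (deriv f) t) t :=
    ((H.smooth_f.deriv' (n := ∞)).differentiable (by simp) t).hasDerivAt
  have ha := hφ'.fun_div (H.hasDerivAt_phi t) (H.phi_ne t)
  have hb := hf'.fun_div (H.hasDerivAt_f t) (H.f_ne t)
  have hc := ((H.hasDerivAt_f t).fun_mul hf').fun_mul ((H.hasDerivAt_phi t).fun_pow 2)
  subst ht
  rw [trace_prod, H.trace_base hp ha hb hc v w rfl rfl rfl,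
    H.trace_fiber hp ha hb hc v w rfl rfl rfl,
    ← hn, ← hm]
  have h0 := H.phi_ne (ξ p.1)
  have h1 := H.f_ne (ξ p.1)
  field_simp
  push_cast
  ring

end IsWarpedOn

/-! ### Hessian, tension and gradients of functions of ξ -/

namespace IsWarpedOn

variable {E₁ E₂ : Type*} [NormedAddCommGroup E₁] [NormedSpace ℝ E₁] [FiniteDimensional ℝ E₁]
  [NormedAddCommGroup E₂] [NormedSpace ℝ E₂] [FiniteDimensional ℝ E₂]
  {ξ : E₁ →L[ℝ] ℝ} {g₀ : E₁ →L[ℝ] E₁ →L[ℝ] ℝ} {A : E₁} {φ f : ℝ → ℝ}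
  {GF : E₂ → E₂ →L[ℝ] E₂ →L[ℝ] ℝ} {V : Set E₂} {p : E₁ × E₂}

theorem localHess_localWarped (H : IsWarpedOn ξ g₀ A φ f GF V) (hp : p.2 ∈ V) {k : ℝ → ℝ}
    (hk : ContDiff ℝ ∞ k) (v w : E₁ × E₂) {t : ℝ} (ht : t = ξ p.1) :
    localHess (localWarped ξ g₀ φ f GF) (fun p : E₁ × E₂ => k (ξ p.1)) p v w =
      (deriv (deriv k) t + 2 * (deriv φ t / φ t) * deriv k t) * (ξ v.1 * ξ w.1) -
        deriv φ t / φ t * deriv k t * ξ A * g₀ v.1 w.1 +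
        deriv f t / f t * deriv k t * ξ A * (f t ^ 2 * φ t ^ 2) * GF p.2 v.2 w.2 := by
  have h2 : fderiv ℝ (fun p : E₁ × E₂ => k (ξ p.1)) = fun p =>
      deriv k (ξ p.1) • (ξ ∘L ContinuousLinearMap.fst ℝ E₁ E₂) :=
    funext fun p => ContinuousLinearMap.ext fun v => fderiv_comp_fst hk p v
  have h3 := (hasFDerivAt_comp_fst (E₂ := E₂) (ξ := ξ) (p := p)
    ((hk.deriv' (n := ∞)).differentiable (by simp) _).hasDerivAt).smul_const
      (ξ ∘L ContinuousLinearMap.fst ℝ E₁ E₂)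
  rw [localHess_apply, fderiv_comp_fst hk, h2, h3.fderiv, H.christoffel_localWarped hp, ← ht]
  have h0 := H.phi_ne t
  have h1 := H.f_ne t
  simp
  field_simp
  ring

theorem trace_localHess_localWarped (H : IsWarpedOn ξ g₀ A φ f GF V) (hp : p.2 ∈ V) {k : ℝ → ℝ}
    (hk : ContDiff ℝ ∞ k) {t : ℝ} (ht : t = ξ p.1) {n m : ℝ} (hn : n = Module.finrank ℝ E₁)
    (hm : m = Module.finrank ℝ E₂) :
    LinearMap.trace ℝ (E₁ × E₂) ((localWarped ξ g₀ φ f GF p).inverse ∘L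
      localHess (localWarped ξ g₀ φ f GF) (fun p : E₁ × E₂ => k (ξ p.1)) p).toLinearMap =
      φ t ^ 2 * (deriv (deriv k) t - (n - 2) * (deriv φ t / φ t) * deriv k t +
        m * deriv k t * (deriv f t / f t)) * ξ A := by
  have h0 := H.phi_ne t
  have h1 := H.f_ne t
  -- Raising an index of the Hessian gives a block-diagonal map: ξ⊗A plus a multiple of the identity
  -- on the base, a multiple of the identity on the fiber.
  have key : ((localWarped ξ g₀ φ f GF p).inverse ∘L
      localHess (localWarped ξ g₀ φ f GF) (fun p : E₁ × E₂ => k (ξ p.1)) p).toLinearMap =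
      LinearMap.prodMap ((φ t ^ 2) • ((deriv (deriv k) t + 2 * (deriv φ t / φ t) * deriv k t) •
        (ξ : E₁ →ₗ[ℝ] ℝ).smulRight A - (deriv φ t / φ t * deriv k t * ξ A) • LinearMap.id))
        ((deriv f t / f t * deriv k t * ξ A * φ t ^ 2) • LinearMap.id) := by
    refine LinearMap.ext fun v => ?_
    rw [ContinuousLinearMap.coe_coe, ContinuousLinearMap.comp_apply,
      (H.isMetricOn.isInvertible hp).inverse_apply_eq]
    refine ContinuousLinearMap.ext fun w => ?_
    rw [H.localHess_localWarped hp hk v w ht, localWarped_apply, ← ht]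
    simp [H.dual]
    field_simp
  rw [key, LinearMap.trace_prodMap']
  simp only [map_sub, map_smul, LinearMap.trace_smulRight, LinearMap.trace_id, smul_eq_mul, ← hn,
    ← hm, ContinuousLinearMap.coe_coe]
  ring

theorem localWarped_inverse_inverse (H : IsWarpedOn ξ g₀ A φ f GF V) (hp : p.2 ∈ V) {k l : ℝ → ℝ}
    (hk : ContDiff ℝ ∞ k) (hl : ContDiff ℝ ∞ l) {t : ℝ} (ht : t = ξ p.1) :
    localWarped ξ g₀ φ f GF p
      ((localWarped ξ g₀ φ f GF p).inverse (fderiv ℝ (fun p : E₁ × E₂ => k (ξ p.1)) p))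
      ((localWarped ξ g₀ φ f GF p).inverse (fderiv ℝ (fun p : E₁ × E₂ => l (ξ p.1)) p)) =
      φ t ^ 2 * (deriv k t * deriv l t) * ξ A := by
  have h0 := H.phi_ne t
  have hinv := H.isMetricOn.isInvertible hp
  have hgrad : (localWarped ξ g₀ φ f GF p).inverse (fderiv ℝ (fun p : E₁ × E₂ => l (ξ p.1)) p) =
      ((φ t ^ 2 * deriv l t) • A, 0) := by
    rw [hinv.inverse_apply_eq]
    refine ContinuousLinearMap.ext fun w => ?_
    rw [fderiv_comp_fst hl, localWarped_apply, ← ht]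
    simp [H.dual]
    field_simp
  -- g(∇k, ∇l) = dk(∇l), so only the gradient of `l` is needed explicitly.
  rw [hinv.self_apply_inverse, hgrad, fderiv_comp_fst hk, ← ht]
  simp
  ring

end IsWarpedOn

/-! ### From charts to the manifold -/

section Manifold

variable {E : Type*} [NormedAddCommGroup E] [NormedSpace ℝ E]
  {H : Type*} [TopologicalSpace H] {I : ModelWithCorners ℝ E H}
  {M : Type*} [TopologicalSpace M] [ChartedSpace H M] [I.Boundaryless]

theorem mfderiv_extChartAt_symm_self [IsManifold I 1 M] (p : M) :
    (mfderiv 𝓘(ℝ, E) I (extChartAt I p).symm (extChartAt I p p) : E →L[ℝ] E) =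
      ContinuousLinearMap.id ℝ E := by
  have := mfderivWithin_range_extChartAt_symm (I := I) (x := p)
  rw [I.range_eq_univ, mfderivWithin_univ] at this
  exact this

theorem inChart_self [IsManifold I 1 M] (g : BilinField I M) (p : M) :
    inChart g p (extChartAt I p p) = (g p : E →L[ℝ] E →L[ℝ] ℝ) := by
  -- The type of `g q` depends on `q`; base point and differential are generalized together so that
  -- both equalities can be substituted.
  have h : ∀ (q : M) (D : E →L[ℝ] E), q = p → D = ContinuousLinearMap.id ℝ E →
      pullbackForm (E := E) (E' := E) (g q) D = (g p : E →L[ℝ] E →L[ℝ] ℝ) := by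
    rintro q D rfl rfl
    rfl
  exact h _ _ (extChartAt_to_inv p) (mfderiv_extChartAt_symm_self p)

theorem pullbackForm_nondegenerate {b : E →L[ℝ] E →L[ℝ] ℝ}
    (hb : ∀ v, (∀ w, b v w = 0) → v = 0) {D : E →L[ℝ] E} (hD : D.IsInvertible) (v : E)
    (hv : ∀ w, pullbackForm b D v w = 0) : v = 0 := by
  refine hD.injective ((hb _ fun w => ?_).trans (map_zero D).symm)
  obtain ⟨z, rfl⟩ := hD.surjective w
  exact hv z

theorem isInvertible_mfderiv_extChartAt_symm [IsManifold I 1 M] {p : M} {y : E}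
    (hy : y ∈ (extChartAt I p).target) :
    (mfderiv 𝓘(ℝ, E) I (extChartAt I p).symm y).IsInvertible := by
  have hinv := isInvertible_mfderivWithin_extChartAt_symm hy
  rwa [I.range_eq_univ, mfderivWithin_univ] at hinv

theorem IsSemiRiemannian.isMetricOn [IsManifold I 1 M] {g : BilinField I M}
    (hg : IsSemiRiemannian g) (p : M) :
    IsMetricOn (inChart g p) (extChartAt I p).target where
  isOpen := isOpen_extChartAt_target p
  smooth := hg.smooth p
  symm y _ v w := by
    rw [inChart_apply, inChart_apply]
    exact hg.symm _ _ _
  nondegenerate y hy v hv :=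
    pullbackForm_nondegenerate (E := E) (hg.nondegenerate ((extChartAt I p).symm y))
      (isInvertible_mfderiv_extChartAt_symm hy) v hv

/-- The pointwise conditions at `p` can be read at the center of the chart at `p`, where the
coordinate form is `g p` itself. -/
theorem IsMetricOn.isSemiRiemannian [IsManifold I 1 M] {g : BilinField I M}
    (h : ∀ p, IsMetricOn (inChart g p) (extChartAt I p).target) : IsSemiRiemannian g where
  symm p v w := by
    have := (h p).symm _ (mem_extChartAt_target p) v w
    rwa [inChart_self] at this
  nondegenerate p v hv := by
    refine (h p).nondegenerate _ (mem_extChartAt_target p) v fun w => ?_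
    rw [inChart_self]
    exact hv w
  smooth p := (h p).smooth

theorem differential_eq_fderiv {a : M → ℝ} {p : M} (ha : MDifferentiableAt I 𝓘(ℝ, ℝ) a p) :
    (differential I a p : E →L[ℝ] ℝ) =
      fderiv ℝ (fun y => a ((extChartAt I p).symm y)) (extChartAt I p p) := by
  have h := ha.mfderiv
  rw [I.range_eq_univ, fderivWithin_univ] at h
  exact h

end Manifold

/-! ### Product charts -/

section Charts

variable {n m : ℕ} {F : Type*} [TopologicalSpace F] [ChartedSpace (EuclideanSpace ℝ (Fin m)) F]

/-- `xi α` as a continuous linear functional. -/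
noncomputable def xiL (α : Fin n → ℝ) : EuclideanSpace ℝ (Fin n) →L[ℝ] ℝ :=
  ∑ i, α i • (EuclideanSpace.proj i : EuclideanSpace ℝ (Fin n) →L[ℝ] ℝ)

theorem xiL_apply (α : Fin n → ℝ) (x : EuclideanSpace ℝ (Fin n)) : xiL α x = xi α x := by
  simp [xiL, xi]

/-- The semi-Euclidean gradient of `xi α`. -/
noncomputable def xiGrad (ε α : Fin n → ℝ) : EuclideanSpace ℝ (Fin n) :=
    WithLp.toLp 2 fun i => ε i * α i

theorem xiL_xiGrad (ε α : Fin n → ℝ) : xiL α (xiGrad ε α) = sqLength ε α := by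
  rw [xiL_apply, xi, sqLength]
  refine Finset.sum_congr rfl fun i _ => ?_
  simp only [xiGrad]
  ring

theorem extChartAt_prod_symm_apply (p : EuclideanSpace ℝ (Fin n) × F)
    (y : EuclideanSpace ℝ (Fin n) × EuclideanSpace ℝ (Fin m)) :
    (extChartAt ((𝓡 n).prod (𝓡 m)) p).symm y = (y.1, (extChartAt (𝓡 m) p.2).symm y.2) := by
  rw [extChartAt_prod, extChartAt_model_space_eq_id]
  rfl

theorem extChartAt_prod_target (p : EuclideanSpace ℝ (Fin n) × F) :
    (extChartAt ((𝓡 n).prod (𝓡 m)) p).target = Prod.snd ⁻¹' (extChartAt (𝓡 m) p.2).target := by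
  rw [extChartAt_prod, extChartAt_model_space_eq_id]
  exact Set.univ_prod

theorem extChartAt_prod_self (p : EuclideanSpace ℝ (Fin n) × F) :
    extChartAt ((𝓡 n).prod (𝓡 m)) p p = (p.1, extChartAt (𝓡 m) p.2 p.2) := by
  rw [extChartAt_prod, extChartAt_model_space_eq_id]
  rfl

theorem mfderiv_extChartAt_prod_symm [IsManifold (𝓡 m) 1 F] (p : EuclideanSpace ℝ (Fin n) × F)
    {y : EuclideanSpace ℝ (Fin n) × EuclideanSpace ℝ (Fin m)}
    (hy : y.2 ∈ (extChartAt (𝓡 m) p.2).target) :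
    (mfderiv 𝓘(ℝ, EuclideanSpace ℝ (Fin n) × EuclideanSpace ℝ (Fin m)) ((𝓡 n).prod (𝓡 m))
      (extChartAt ((𝓡 n).prod (𝓡 m)) p).symm y :
        EuclideanSpace ℝ (Fin n) × EuclideanSpace ℝ (Fin m) →L[ℝ]
        EuclideanSpace ℝ (Fin n) × EuclideanSpace ℝ (Fin m)) =
      (ContinuousLinearMap.fst ℝ _ _).prod
        ((mfderiv (𝓡 m) (𝓡 m) (extChartAt (𝓡 m) p.2).symm y.2 :
          EuclideanSpace ℝ (Fin m) →L[ℝ] EuclideanSpace ℝ (Fin m)) ∘L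
            ContinuousLinearMap.snd ℝ _ _) := by
  have hfun : ((extChartAt ((𝓡 n).prod (𝓡 m)) p).symm :
      EuclideanSpace ℝ (Fin n) × EuclideanSpace ℝ (Fin m) → EuclideanSpace ℝ (Fin n) × F) =
      fun y => (y.1, (extChartAt (𝓡 m) p.2).symm y.2) :=
    funext (extChartAt_prod_symm_apply p)
  rw [hfun]
  have h1 := (hasFDerivAt_fst (𝕜 := ℝ) (p := y)).hasMFDerivAt
  have h2 := (hasFDerivAt_snd (𝕜 := ℝ) (p := y)).hasMFDerivAt
  have h3 : MDifferentiableAt (𝓡 m) (𝓡 m) (extChartAt (𝓡 m) p.2).symm y.2 := by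
    have := mdifferentiableWithinAt_extChartAt_symm (I := 𝓡 m) hy
    rwa [ModelWithCorners.range_eq_univ, mdifferentiableWithinAt_univ] at this
  exact (h1.prodMk (h3.hasMFDerivAt.comp y h2)).mfderiv

theorem inChart_warpedMetric [IsManifold (𝓡 m) 1 F] (gF : BilinField (𝓡 m) F) (ε α : Fin n → ℝ)
    (φ f : ℝ → ℝ) (p : EuclideanSpace ℝ (Fin n) × F)
    {y : EuclideanSpace ℝ (Fin n) × EuclideanSpace ℝ (Fin m)}
    (hy : y.2 ∈ (extChartAt (𝓡 m) p.2).target) :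
    inChart (warpedMetric (conformalMetric ε (φ ∘ xi α)) (f ∘ xi α) gF) p y =
      localWarped (xiL α) (semiEuclidean ε) φ f (inChart gF p.2) y := by
  have key : ∀ (x : EuclideanSpace ℝ (Fin n) × F)
      (D : EuclideanSpace ℝ (Fin n) × EuclideanSpace ℝ (Fin m) →L[ℝ]
        EuclideanSpace ℝ (Fin n) × EuclideanSpace ℝ (Fin m)),
      x = (y.1, (extChartAt (𝓡 m) p.2).symm y.2) →
      D = (ContinuousLinearMap.fst ℝ _ _).prod
        ((mfderiv (𝓡 m) (𝓡 m) (extChartAt (𝓡 m) p.2).symm y.2 :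
          EuclideanSpace ℝ (Fin m) →L[ℝ] EuclideanSpace ℝ (Fin m)) ∘L
            ContinuousLinearMap.snd ℝ _ _) →
      pullbackForm (E := EuclideanSpace ℝ (Fin n) × EuclideanSpace ℝ (Fin m))
        (E' := EuclideanSpace ℝ (Fin n) × EuclideanSpace ℝ (Fin m))
        (warpedMetric (conformalMetric ε (φ ∘ xi α)) (f ∘ xi α) gF x) D =
      localWarped (xiL α) (semiEuclidean ε) φ f (inChart gF p.2) y := by
    rintro x D rfl rfl
    unfold warpedMetric pullback
    rw [mfderiv_fst, mfderiv_snd]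
    refine ContinuousLinearMap.ext fun v => ContinuousLinearMap.ext fun w => ?_
    rw [localWarped_apply, xiL_apply]
    rfl
  exact key _ _ (extChartAt_prod_symm_apply p y) (mfderiv_extChartAt_prod_symm p hy)

end Charts

/-! ### Ricci tensor, Hessian and tension of the global warped product -/

section WarpedMetric

variable {n m : ℕ} {F : Type*} [TopologicalSpace F] [ChartedSpace (EuclideanSpace ℝ (Fin m)) F]
  {gF : BilinField (𝓡 m) F} {ε α : Fin n → ℝ} {φ f : ℝ → ℝ}

/-- The hypotheses on the data of the warped product. -/
structure IsWarpedData (gF : BilinField (𝓡 m) F) (ε : Fin n → ℝ) (φ f : ℝ → ℝ) : Prop where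
  fiber : IsSemiRiemannian gF
  sign : ∀ i, ε i = 1 ∨ ε i = -1
  smooth_phi : ContDiff ℝ ∞ φ
  smooth_f : ContDiff ℝ ∞ f
  phi_ne : ∀ t, φ t ≠ 0
  f_ne : ∀ t, f t ≠ 0

/-- The warped product metric. -/
noncomputable abbrev warped (gF : BilinField (𝓡 m) F) (ε α : Fin n → ℝ) (φ f : ℝ → ℝ) :
    BilinField ((𝓡 n).prod (𝓡 m)) (EuclideanSpace ℝ (Fin n) × F) :=
  warpedMetric (conformalMetric ε (φ ∘ xi α)) (f ∘ xi α) gF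

theorem warped_apply (p : EuclideanSpace ℝ (Fin n) × F)
    (v w : EuclideanSpace ℝ (Fin n) × EuclideanSpace ℝ (Fin m)) :
    warped gF ε α φ f p v w = (φ (xi α p.1) ^ 2)⁻¹ * semiEuclidean ε v.1 w.1 +
      f (xi α p.1) ^ 2 * gF p.2 v.2 w.2 := by
  unfold warped warpedMetric pullback
  rw [mfderiv_fst, mfderiv_snd]
  rfl

theorem comp_extChartAt_prod_symm (k : ℝ → ℝ) (p : EuclideanSpace ℝ (Fin n) × F) :
    (fun y => ((k ∘ xi α) ∘ Prod.fst) ((extChartAt ((𝓡 n).prod (𝓡 m)) p).symm y)) =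
      fun y => k (xiL α y.1) := by
  funext y
  rw [extChartAt_prod_symm_apply, xiL_apply]
  rfl

theorem contMDiff_comp_xi {k : ℝ → ℝ} (hk : ContDiff ℝ ∞ k) (α : Fin n → ℝ) :
    ContMDiff ((𝓡 n).prod (𝓡 m)) 𝓘(ℝ, ℝ) ∞
      ((k ∘ xi α) ∘ Prod.fst : EuclideanSpace ℝ (Fin n) × F → ℝ) := by
  have h : xi α = xiL α := funext fun x => (xiL_apply α x).symm
  rw [h]
  exact (hk.comp (xiL α).contDiff).contMDiff.comp contMDiff_fst

theorem differential_comp_xi {k : ℝ → ℝ} (hk : ContDiff ℝ ∞ k) (α : Fin n → ℝ)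
    (p : EuclideanSpace ℝ (Fin n) × F) :
    differential ((𝓡 n).prod (𝓡 m)) ((k ∘ xi α) ∘ Prod.fst) p =
      (fderiv ℝ (fun y : EuclideanSpace ℝ (Fin n) × EuclideanSpace ℝ (Fin m) => k (xiL α y.1))
        (p.1, extChartAt (𝓡 m) p.2 p.2) :) := by
  have h := differential_eq_fderiv ((contMDiff_comp_xi (m := m) (F := F) hk α).mdifferentiable
    (by simp) p)
  rw [comp_extChartAt_prod_symm, extChartAt_prod_self] at h
  exact h

theorem differential_comp_xi_apply {k : ℝ → ℝ} (hk : ContDiff ℝ ∞ k) (α : Fin n → ℝ)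
    (p : EuclideanSpace ℝ (Fin n) × F)
    (v : EuclideanSpace ℝ (Fin n) × EuclideanSpace ℝ (Fin m)) :
    differential ((𝓡 n).prod (𝓡 m)) ((k ∘ xi α) ∘ Prod.fst) p v =
      deriv k (xi α p.1) * xi α v.1 := by
  rw [differential_comp_xi hk, ← xiL_apply, ← xiL_apply]
  exact fderiv_comp_fst hk _ v

variable [IsManifold (𝓡 m) ∞ F]

theorem inChart_warped_eventuallyEq (p : EuclideanSpace ℝ (Fin n) × F) :
    inChart (warped gF ε α φ f) p =ᶠ[nhds (p.1, extChartAt (𝓡 m) p.2 p.2)]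
      localWarped (xiL α) (semiEuclidean ε) φ f (inChart gF p.2) := by
  have : IsManifold (𝓡 m) 1 F := IsManifold.of_le (n := ∞) (by norm_cast)
  have h := (isOpen_extChartAt_target (I := 𝓡 m) p.2).preimage
    (continuous_snd (X := EuclideanSpace ℝ (Fin n)))
  filter_upwards [h.mem_nhds (mem_extChartAt_target (I := 𝓡 m) p.2)] with y hy
  exact inChart_warpedMetric gF ε α φ f p hy

theorem warped_eq_localWarped (p : EuclideanSpace ℝ (Fin n) × F) :
    warped gF ε α φ f p = (localWarped (xiL α) (semiEuclidean ε) φ f (inChart gF p.2)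
      (p.1, extChartAt (𝓡 m) p.2 p.2) :) := by
  have : IsManifold (𝓡 m) 1 F := IsManifold.of_le (n := ∞) (by norm_cast)
  have h :=
    (inChart_warped_eventuallyEq (gF := gF) (ε := ε) (α := α) (φ := φ) (f := f) p).eq_of_nhds
  rw [← extChartAt_prod_self, inChart_self] at h
  rw [extChartAt_prod_self] at h
  exact h

namespace IsWarpedData

theorem isWarpedOn (D : IsWarpedData gF ε φ f) (α : Fin n → ℝ) (q : F) :
    IsWarpedOn (xiL α) (semiEuclidean ε) (xiGrad ε α) φ f (inChart gF q)
      (extChartAt (𝓡 m) q).target where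
  symm v w := by
    rw [semiEuclidean_apply, semiEuclidean_apply]
    exact Finset.sum_congr rfl fun i _ => by ring
  nondegenerate v hv := by
    ext i
    have := hv (EuclideanSpace.single i 1)
    rw [semiEuclidean_apply, Finset.sum_eq_single i (by simp +contextual) (by simp)] at this
    rcases D.sign i with h | h <;> simpa [h] using this
  dual v := by
    rw [semiEuclidean_apply, xiL_apply, xi]
    refine Finset.sum_congr rfl fun i _ => ?_
    -- ε_i² = 1, so pairing with the vector (ε_i α_i) recovers ξ.
    rcases D.sign i with h | h <;> simp [xiGrad, h]
  smooth_phi := D.smooth_phi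
  smooth_f := D.smooth_f
  phi_ne := D.phi_ne
  f_ne := D.f_ne
  fiber :=
    have : IsManifold (𝓡 m) 1 F := IsManifold.of_le (n := ∞) (by norm_cast)
    D.fiber.isMetricOn q

theorem isSemiRiemannian (D : IsWarpedData gF ε φ f) (α : Fin n → ℝ) :
    IsSemiRiemannian (warped gF ε α φ f) := by
  have : IsManifold (𝓡 m) 1 F := IsManifold.of_le (n := ∞) (by norm_cast)
  refine IsMetricOn.isSemiRiemannian fun p => ?_
  have h := (D.isWarpedOn α p.2).isMetricOn
  rw [← extChartAt_prod_target p] at h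
  have heq : Set.EqOn (inChart (warped gF ε α φ f) p)
      (localWarped (xiL α) (semiEuclidean ε) φ f (inChart gF p.2))
      (extChartAt ((𝓡 n).prod (𝓡 m)) p).target := fun y hy =>
    inChart_warpedMetric gF ε α φ f p (by rwa [extChartAt_prod_target] at hy)
  exact ⟨h.isOpen, h.smooth.congr heq, fun y hy => by rw [heq hy]; exact h.symm y hy,
    fun y hy => by rw [heq hy]; exact h.nondegenerate y hy⟩

theorem ricci_warped (D : IsWarpedData gF ε φ f) (p : EuclideanSpace ℝ (Fin n) × F)
    (v w : EuclideanSpace ℝ (Fin n) × EuclideanSpace ℝ (Fin m)) {t : ℝ} (ht : t = xi α p.1) :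
    ricci (warped gF ε α φ f) p v w = ricci gF p.2 v.2 w.2 +
      ((n - 2) * (deriv (deriv φ) t / φ t) - m * (deriv (deriv f) t / f t)
        - 2 * m * (deriv φ t / φ t) * (deriv f t / f t)) * (xi α v.1 * xi α w.1) +
      (deriv (deriv φ) t / φ t - (n - 1) * (deriv φ t / φ t) ^ 2
        + m * (deriv φ t / φ t) * (deriv f t / f t)) * sqLength ε α * semiEuclidean ε v.1 w.1 -
      (deriv (deriv f) t / f t - (n - 2) * (deriv φ t / φ t) * (deriv f t / f t)
        + (m - 1) * (deriv f t / f t) ^ 2) * sqLength ε α * (f t ^ 2 * φ t ^ 2) *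
          gF p.2 v.2 w.2 := by
  have : IsManifold (𝓡 m) 1 F := IsManifold.of_le (n := ∞) (by norm_cast)
  have h := (D.isWarpedOn α p.2).trace_curvature_localWarped
    (p := (p.1, extChartAt (𝓡 m) p.2 p.2)) (mem_extChartAt_target (I := 𝓡 m) p.2) v w
    (ht.trans (xiL_apply α p.1).symm) (n := n) (m := m) (by simp) (by simp)
  rw [← curvature_congr (inChart_warped_eventuallyEq (gF := gF) p), inChart_self,
    ← extChartAt_prod_self, xiL_xiGrad, xiL_apply, xiL_apply] at h
  exact h

theorem hess_warped (D : IsWarpedData gF ε φ f) {k : ℝ → ℝ} (hk : ContDiff ℝ ∞ k)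
    (p : EuclideanSpace ℝ (Fin n) × F)
    (v w : EuclideanSpace ℝ (Fin n) × EuclideanSpace ℝ (Fin m)) {t : ℝ} (ht : t = xi α p.1) :
    hess (warped gF ε α φ f) ((k ∘ xi α) ∘ Prod.fst) p v w =
      (deriv (deriv k) t + 2 * (deriv φ t / φ t) * deriv k t) * (xi α v.1 * xi α w.1) -
        deriv φ t / φ t * deriv k t * sqLength ε α * semiEuclidean ε v.1 w.1 +
        deriv f t / f t * deriv k t * sqLength ε α * (f t ^ 2 * φ t ^ 2) * gF p.2 v.2 w.2 := by
  have : IsManifold (𝓡 m) 1 F := IsManifold.of_le (n := ∞) (by norm_cast)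
  have h := (D.isWarpedOn α p.2).localHess_localWarped
    (p := (p.1, extChartAt (𝓡 m) p.2 p.2)) (mem_extChartAt_target (I := 𝓡 m) p.2) hk v w
    (ht.trans (xiL_apply α p.1).symm)
  rw [← localHess_congr (inChart_warped_eventuallyEq (gF := gF) p), inChart_self,
    ← extChartAt_prod_self, xiL_xiGrad, xiL_apply, xiL_apply,
    ← comp_extChartAt_prod_symm (m := m) k p] at h
  exact h

theorem tension_warped (D : IsWarpedData gF ε φ f) {k : ℝ → ℝ} (hk : ContDiff ℝ ∞ k)
    (p : EuclideanSpace ℝ (Fin n) × F) {t : ℝ} (ht : t = xi α p.1) :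
    tension (warped gF ε α φ f) ((k ∘ xi α) ∘ Prod.fst) p =
      φ t ^ 2 * (deriv (deriv k) t - (n - 2) * (deriv φ t / φ t) * deriv k t +
        m * deriv k t * (deriv f t / f t)) * sqLength ε α := by
  have h := (D.isWarpedOn α p.2).trace_localHess_localWarped
    (p := (p.1, extChartAt (𝓡 m) p.2 p.2)) (mem_extChartAt_target (I := 𝓡 m) p.2) hk
    (ht.trans (xiL_apply α p.1).symm) (n := n) (m := m) (by simp) (by simp)
  rw [← localHess_congr (inChart_warped_eventuallyEq (gF := gF) p),
    ← warped_eq_localWarped, ← extChartAt_prod_self, xiL_xiGrad,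
    ← comp_extChartAt_prod_symm (m := m) k p] at h
  exact h

theorem grad_warped (D : IsWarpedData gF ε φ f) {k l : ℝ → ℝ} (hk : ContDiff ℝ ∞ k)
    (hl : ContDiff ℝ ∞ l) (p : EuclideanSpace ℝ (Fin n) × F) {t : ℝ} (ht : t = xi α p.1) :
    warped gF ε α φ f p (grad (warped gF ε α φ f) ((k ∘ xi α) ∘ Prod.fst) p)
      (grad (warped gF ε α φ f) ((l ∘ xi α) ∘ Prod.fst) p) =
      φ t ^ 2 * (deriv k t * deriv l t) * sqLength ε α := by
  have h := (D.isWarpedOn α p.2).localWarped_inverse_inverse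
    (p := (p.1, extChartAt (𝓡 m) p.2 p.2)) (mem_extChartAt_target (I := 𝓡 m) p.2) hk hl
    (ht.trans (xiL_apply α p.1).symm)
  rw [← warped_eq_localWarped, xiL_xiGrad, ← differential_comp_xi hk, ← differential_comp_xi hl] at h
  exact h

end IsWarpedData

end WarpedMetric

/-! ### Equivalence of the soliton equations and the system -/

section Soliton

theorem xi_surjective {n : ℕ} {α : Fin n → ℝ} (hα : α ≠ 0) : Function.Surjective (xi α) := by
  intro t
  obtain ⟨i, hi⟩ := Function.ne_iff.1 hα
  refine ⟨EuclideanSpace.single i (t / α i), ?_⟩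
  rw [xi, Finset.sum_eq_single i (by simp +contextual) (by simp)]
  simpa using mul_div_cancel₀ t hi

theorem xi_single {n : ℕ} (α : Fin n → ℝ) (i : Fin n) : xi α (EuclideanSpace.single i 1) = α i := by
  rw [xi, Finset.sum_eq_single i (by simp +contextual) (by simp)]
  simp

theorem semiEuclidean_single {n : ℕ} (ε : Fin n → ℝ) (i j : Fin n) :
    semiEuclidean ε (EuclideanSpace.single i 1) (EuclideanSpace.single j 1) =
      if i = j then ε i else 0 := by
  rw [semiEuclidean_apply, Finset.sum_eq_single i (by simp +contextual) (by simp)]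
  simp

/-- The rank of ξ⊗ξ is one and that of g₀ is n ≥ 2. Concretely, one compares matrix entries at an
index i with α_i ≠ 0 and any other index j. -/
theorem eq_zero_of_xi_mul_xi_add_semiEuclidean {n : ℕ} (hn : 2 ≤ n) {ε α : Fin n → ℝ}
    (hε : ∀ i, ε i = 1 ∨ ε i = -1) (hα : α ≠ 0) {a b : ℝ}
    (h : ∀ v w, a * (xi α v * xi α w) + b * semiEuclidean ε v w = 0) : a = 0 ∧ b = 0 := by
  obtain ⟨i, hi⟩ := Function.ne_iff.1 hα
  have : Nontrivial (Fin n) := Fin.nontrivial_iff_two_le.2 hn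
  obtain ⟨j, hj⟩ := exists_ne i
  have key (k l : Fin n) : a * (α k * α l) + b * (if k = l then ε k else 0) = 0 := by
    simpa only [xi_single, semiEuclidean_single] using
      h (EuclideanSpace.single k 1) (EuclideanSpace.single l 1)
  have hε0 (k : Fin n) : ε k ≠ 0 := by rcases hε k with h | h <;> simp [h]
  have hii := key i i
  have hjj := key j j
  have hij := key i j
  simp only [if_true, if_neg hj.symm, mul_zero, add_zero] at hii hjj hij
  have hi : α i ≠ 0 := hi
  -- The (i, j) entry is a α_i α_j. If α_j = 0, the (j, j) entry gives b = 0, and then the (i, i)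
  -- entry gives a = 0.
  have ha : a = 0 := by
    rcases mul_eq_zero.1 hij with h | h
    · exact h
    have hαj : α j = 0 := (mul_eq_zero.1 h).resolve_left hi
    have hb : b = 0 := by
      rw [hαj] at hjj
      simpa [hε0] using hjj
    simpa [hb, hi] using hii
  exact ⟨ha, by simpa [ha, hε0] using hii⟩

variable {n m : ℕ} {F : Type*} [TopologicalSpace F] [ChartedSpace (EuclideanSpace ℝ (Fin m)) F]
  [IsManifold (𝓡 m) ∞ F] {gF : BilinField (𝓡 m) F} {ε α : Fin n → ℝ} {φ f h u : ℝ → ℝ}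

namespace IsWarpedData

theorem soliton_eq (D : IsWarpedData gF ε φ f) (hh : ContDiff ℝ ∞ h) (hu : ContDiff ℝ ∞ u)
    (θ lam : ℝ) (p : EuclideanSpace ℝ (Fin n) × F)
    (v w : EuclideanSpace ℝ (Fin n) × EuclideanSpace ℝ (Fin m)) {t : ℝ} (ht : t = xi α p.1) :
    ricci (warped gF ε α φ f) p v w + hess (warped gF ε α φ f) ((h ∘ xi α) ∘ Prod.fst) p v w -
      θ * (differential ((𝓡 n).prod (𝓡 m)) ((u ∘ xi α) ∘ Prod.fst) p v *
        differential ((𝓡 n).prod (𝓡 m)) ((u ∘ xi α) ∘ Prod.fst) p w) -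
      lam * warped gF ε α φ f p v w =
    ricci gF p.2 v.2 w.2 +
      (((n : ℝ) - 2) * (deriv (deriv φ) t / φ t) - m * (deriv (deriv f) t / f t)
        - 2 * m * (deriv φ t / φ t) * (deriv f t / f t) + deriv (deriv h) t
        + 2 * (deriv φ t / φ t) * deriv h t - θ * deriv u t ^ 2) * (xi α v.1 * xi α w.1) +
      ((deriv (deriv φ) t / φ t - ((n : ℝ) - 1) * (deriv φ t / φ t) ^ 2
        + m * (deriv φ t / φ t) * (deriv f t / f t) - deriv φ t / φ t * deriv h t) *
          sqLength ε α - lam / φ t ^ 2) * semiEuclidean ε v.1 w.1 -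
      ((deriv (deriv f) t / f t - ((n : ℝ) - 2) * (deriv φ t / φ t) * (deriv f t / f t)
        + ((m : ℝ) - 1) * (deriv f t / f t) ^ 2 - deriv f t / f t * deriv h t) * sqLength ε α *
          (f t ^ 2 * φ t ^ 2) + lam * f t ^ 2) * gF p.2 v.2 w.2 := by
  rw [D.ricci_warped p v w ht, D.hess_warped hh p v w ht, differential_comp_xi_apply hu,
    differential_comp_xi_apply hu, warped_apply, ← ht]
  ring

theorem tension_sub (D : IsWarpedData gF ε φ f) (hh : ContDiff ℝ ∞ h) (hu : ContDiff ℝ ∞ u)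
    (p : EuclideanSpace ℝ (Fin n) × F) {t : ℝ} (ht : t = xi α p.1) :
    tension (warped gF ε α φ f) ((u ∘ xi α) ∘ Prod.fst) p -
      warped gF ε α φ f p (grad (warped gF ε α φ f) ((u ∘ xi α) ∘ Prod.fst) p)
        (grad (warped gF ε α φ f) ((h ∘ xi α) ∘ Prod.fst) p) =
    φ t ^ 2 * ((deriv (deriv u) t - ((n : ℝ) - 2) * (deriv φ t / φ t) * deriv u t
      + m * deriv u t * (deriv f t / f t) - deriv u t * deriv h t) * sqLength ε α) := by
  rw [D.tension_warped hu p ht, D.grad_warped hu hh p ht]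
  ring

theorem isGRHS_of_solvesSystem (D : IsWarpedData gF ε φ f) (hh : ContDiff ℝ ∞ h)
    (hu : ContDiff ℝ ∞ u) {θ lam μ : ℝ} (hθ : 0 ≤ θ) (hμ : IsEinstein gF μ)
    (hs : ∀ t, SolvesSystemAt n m (sqLength ε α) θ lam μ φ f h u t) :
    IsGRHS (warped gF ε α φ f) ((u ∘ xi α) ∘ Prod.fst) ((h ∘ xi α) ∘ Prod.fst) θ lam where
  isSemiRiemannian := D.isSemiRiemannian α
  theta_nonneg := hθ
  smooth_map := contMDiff_comp_xi hu α
  smooth_potential := contMDiff_comp_xi hh α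
  ricci_eq := by
    intro p (v : EuclideanSpace ℝ (Fin n) × EuclideanSpace ℝ (Fin m))
      (w : EuclideanSpace ℝ (Fin n) × EuclideanSpace ℝ (Fin m))
    have hr : ricci gF p.2 v.2 w.2 = μ * gF p.2 v.2 w.2 := hμ _ _ _
    rw [← sub_eq_zero]
    refine (D.soliton_eq hh hu θ lam p v w rfl).trans ?_
    rw [(hs _).eq1, (hs _).eq2, (hs _).eq3, hr]
    have h0 := D.phi_ne (xi α p.1)
    have h1 := D.f_ne (xi α p.1)
    field_simp
    ring
  tension_eq p := by
    refine (D.tension_sub hh hu p rfl).trans ?_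
    rw [(hs _).eq4, mul_zero]

theorem solvesSystem_of_isGRHS [Nonempty F] (hm : 1 ≤ m) (hn : 2 ≤ n) (hα : α ≠ 0)
    (D : IsWarpedData gF ε φ f) (hh : ContDiff ℝ ∞ h) (hu : ContDiff ℝ ∞ u) {θ lam : ℝ}
    (H : IsGRHS (warped gF ε α φ f) ((u ∘ xi α) ∘ Prod.fst) ((h ∘ xi α) ∘ Prod.fst) θ lam) :
    ∃ μ, IsEinstein gF μ ∧ ∀ t, SolvesSystemAt n m (sqLength ε α) θ lam μ φ f h u t := by
  have key (p : EuclideanSpace ℝ (Fin n) × F)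
      (v w : EuclideanSpace ℝ (Fin n) × EuclideanSpace ℝ (Fin m)) (t : ℝ) (ht : t = xi α p.1) :=
    (D.soliton_eq hh hu θ lam p v w ht).symm.trans (sub_eq_zero.2 (H.ricci_eq p v w))
  -- This is the third equation solved for μ.
  set κ : ℝ → ℝ := fun t =>
    (deriv (deriv f) t / f t - ((n : ℝ) - 2) * (deriv φ t / φ t) * (deriv f t / f t)
      + ((m : ℝ) - 1) * (deriv f t / f t) ^ 2 - deriv f t / f t * deriv h t) * sqLength ε α *
        (f t ^ 2 * φ t ^ 2) + lam * f t ^ 2 with hκ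
  have hfib (t : ℝ) (q : F) (v w : EuclideanSpace ℝ (Fin m)) :
      ricci gF q v w = κ t * gF q v w := by
    obtain ⟨x, rfl⟩ := xi_surjective hα t
    have := key (x, q) (0, v) (0, w) _ rfl
    rw [← sub_eq_zero]
    refine Eq.trans ?_ this
    simp [hκ, xi]
  obtain ⟨q⟩ := ‹Nonempty F›
  have hconst (t : ℝ) : κ t = κ 0 := by
    -- As m ≥ 1 there is a nonzero vector, so the nondegenerate form at `q` is not zero; this lets
    -- κ(t) be cancelled against κ(0).
    obtain ⟨v, w, hvw⟩ : ∃ v w : EuclideanSpace ℝ (Fin m), gF q v w ≠ 0 := by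
      by_contra! hcon
      have hz : EuclideanSpace.single (⟨0, hm⟩ : Fin m) (1 : ℝ) = 0 :=
        D.fiber.nondegenerate q _ (hcon _)
      simp at hz
    exact mul_right_cancel₀ hvw ((hfib t q v w).symm.trans (hfib 0 q v w))
  -- On horizontal vectors the fiber terms vanish; `a` and `b` are read off from `soliton_eq`.
  have hbase (t : ℝ) := eq_zero_of_xi_mul_xi_add_semiEuclidean hn D.sign hα (a := _) (b := _)
    fun v w => by
      obtain ⟨x, hx⟩ := xi_surjective hα t
      have hk := key (x, q) (v, 0) (w, 0) t hx.symm
      have hz : gF q (0 : EuclideanSpace ℝ (Fin m)) (0 : EuclideanSpace ℝ (Fin m)) = 0 :=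
        map_zero (gF q (0 : EuclideanSpace ℝ (Fin m)))
      have hr : ricci gF q (0 : EuclideanSpace ℝ (Fin m)) (0 : EuclideanSpace ℝ (Fin m)) = 0 := by
        rw [hfib t, hz, mul_zero]
      rwa [hr, hz, mul_zero, sub_zero, zero_add] at hk
  refine ⟨κ 0, hfib 0, fun t => ⟨(hbase t).1, sub_eq_zero.1 (hbase t).2, ?_, ?_⟩⟩
  · have h0 := D.phi_ne t
    have h1 := D.f_ne t
    rw [← hconst t, hκ]
    field_simp
    ring
  · obtain ⟨x, hx⟩ := xi_surjective hα t
    have := (D.tension_sub hh hu (x, q) hx.symm).symm.trans (H.tension_eq (x, q))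
    exact (mul_eq_zero.1 this).resolve_left (pow_ne_zero 2 (D.phi_ne t))

end IsWarpedData

end Soliton

end GRHS

theorem theorem3 {n m : ℕ} (hm : 1 ≤ m)
    {F : Type*} [TopologicalSpace F] [ChartedSpace (EuclideanSpace ℝ (Fin m)) F]
    [IsManifold (𝓡 m) ∞ F] [Nonempty F]
    (gF : GRHS.BilinField (𝓡 m) F) (hgF : GRHS.IsSemiRiemannian gF)
    (ε α : Fin n → ℝ) (hε : ∀ i, ε i = 1 ∨ ε i = -1) (hα : α ≠ 0)
    (φ f h u : ℝ → ℝ)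
    (hφ : ContDiff ℝ ∞ φ) (hf : ContDiff ℝ ∞ f) (hh : ContDiff ℝ ∞ h) (hu : ContDiff ℝ ∞ u)
    (hφ0 : ∀ t, φ t ≠ 0) (hf0 : ∀ t, 0 < f t)
    (θ lam : ℝ) (hθ : 0 ≤ θ)
    (g : GRHS.BilinField ((𝓡 n).prod (𝓡 m)) (EuclideanSpace ℝ (Fin n) × F))
    (hg : g = GRHS.warpedMetric (GRHS.conformalMetric ε (φ ∘ GRHS.xi α)) (f ∘ GRHS.xi α) gF)
    (U P : EuclideanSpace ℝ (Fin n) × F → ℝ)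
    (hU : U = (u ∘ GRHS.xi α) ∘ Prod.fst) (hP : P = (h ∘ GRHS.xi α) ∘ Prod.fst) :
    (2 ≤ n →
      ((GRHS.IsGRHS g U P θ lam ∧ ∃ p q, U p ≠ U q) ↔
        ((∃ s t, u s ≠ u t) ∧ ∃ μ : ℝ, GRHS.IsEinstein gF μ ∧
          ∀ t, GRHS.SolvesSystemAt n m (GRHS.sqLength ε α) θ lam μ φ f h u t))) ∧
    (((∃ s t, u s ≠ u t) ∧ ∃ μ : ℝ, GRHS.IsEinstein gF μ ∧
        ∀ t, GRHS.SolvesSystemAt n m (GRHS.sqLength ε α) θ lam μ φ f h u t) →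
      (GRHS.IsGRHS g U P θ lam ∧ ∃ p q, U p ≠ U q)) := by
  subst hg hU hP
  have D : GRHS.IsWarpedData gF ε φ f := ⟨hgF, hε, hφ, hf, hφ0, fun t => (hf0 t).ne'⟩
  have hBA : ((∃ s t, u s ≠ u t) ∧ ∃ μ : ℝ, GRHS.IsEinstein gF μ ∧
        ∀ t, GRHS.SolvesSystemAt n m (GRHS.sqLength ε α) θ lam μ φ f h u t) →
      (GRHS.IsGRHS (GRHS.warped gF ε α φ f) ((u ∘ GRHS.xi α) ∘ Prod.fst)
        ((h ∘ GRHS.xi α) ∘ Prod.fst) θ lam ∧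
        ∃ p q : EuclideanSpace ℝ (Fin n) × F,
          ((u ∘ GRHS.xi α) ∘ Prod.fst) p ≠ ((u ∘ GRHS.xi α) ∘ Prod.fst) q) := by
    rintro ⟨⟨s, t, hst⟩, μ, hμ, hs⟩
    refine ⟨D.isGRHS_of_solvesSystem hh hu hθ hμ hs, ?_⟩
    -- Two parameters separated by `u` lift to points of M, since ξ is onto and F is non-empty.
    obtain ⟨x, rfl⟩ := GRHS.xi_surjective hα s
    obtain ⟨y, rfl⟩ := GRHS.xi_surjective hα t
    obtain ⟨q⟩ := ‹Nonempty F›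
    exact ⟨(x, q), (y, q), hst⟩
  refine ⟨fun hn => ⟨?_, hBA⟩, hBA⟩
  rintro ⟨H, p, q, hpq⟩
  exact ⟨⟨_, _, hpq⟩, D.solvesSystem_of_isGRHS hm hn hα hh hu H⟩
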